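/- Consider a connected power network with $n\ge 1$ nodes and $\ell$ transmission lines with positive susceptances, line capacities $f\in\mathbb{R}^{\ell}$, and shift-factor matrix $H\in\mathbb{R}^{\ell\times n}$ of the linearized DC power-flow model (so $Hp$ is the vector of line flows caused by a vector $p$ of nodal injections with $\mathbf 1^\top p=0$). Node $k$ has a generator that produces $q_k\ge 0$ at cost $c_kq_k^2$, $c_k>0$, and a demand with inverse demand function $p_k(d)=a_k-b_kd$, $a_k>0$, $b_k\ge 0$. Given $q$, the market maker chooses re-balancing quantities $$r\in S^M(q)=\{r\in\mathbb{R}^n : q+r\ge 0,\ |Hr|\le f,\ \mathbf 1^\top r=0\}.$$ Generator $k$ maximizes its profit $\pi^G_k(q,r)=q_kp_k(q_k+r_k)-c_kq_k^2$ over $q_k\ge 0$, and the market maker maximizes an objective $\pi^M(q,r)$ over $r\in S^M(q)$, where $\pi^M$ is one of $$W_{soc}(q,r)=\sum_k\Big(\int_0^{q_k+r_k}p_k(w)\,dw-c_kq_k^2\Big),\qquad W_{res}(q,r)=W_{soc}(q,r)-\sum_k\pi^G_k(q,r),$$ $$W_{con}(q,r)=\sum_k\Big(\int_0^{q_k+r_k}p_k(w)\,dw-(q_k+r_k)\,p_k(q_k+r_k)\Big)$$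 (social welfare, residual social welfare, consumer surplus). A generalized Nash equilibrium (GNE) is a pair $(q^*,r^*)$ with $q^*\ge 0$ and $r^*\in S^M(q^*)$ such that, for each $k$, $q_k^*$ maximizes $\pi_k^G$ over $q_k\ge 0$ when the other components of $q^*$ and $r^*$ are fixed, and $r^*$ maximizes $\pi^M(q^*,\cdot)$ over $S^M(q^*)$. The game is feasible if there are $q\ge 0$ and $r\in S^M(q)$. **Theorem.** (i) If the game is feasible and $\pi^M=W_{soc}$ or $\pi^M=W_{res}$, then a GNE exists. (ii) If $\pi^M=W_{con}$, a GNE may fail to exist. Namely, let the network consist of two nodes joined by a single line of capacity $f_{12}$, and let $a_1=a_2=a$, $c_1=c_2=c$, $1<b_1/b_2\le 3$ and $$\frac{a}{3b_1+2c}<f_{12}<\min\Big\{\frac{a}{b_2+2c},\ \frac{a}{b_1},\ \frac{ab_2\,[\,b_1+b_2+c(3-b_1/b_2)\,]}{b_1b_2(b_1+b_2)+b_1(b_1+5b_2)c+2(b_1+b_2)c^2}\Big\}.$$ Then there is no GNE for $\pi^M=W_{con}$. In particular, the game with $a=10$, $b_1=1.2$, $b_2=1$, $c=1$, $f_{12}=2$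 is feasible and has no GNE for $\pi^M=W_{con}$. -/

import Mathlib

namespace NetworkedCournot

open Matrix

/-- A power network with `n` nodes and `l` transmission lines (parallel lines are allowed).
Each line `e` joins two distinct nodes, has a positive susceptance (linearized DC model) and a
capacity. The network is connected. The node `slack` is the reference node used to write down the
shift-factor matrix. -/
structure Network (n l : ℕ) where
  /-- the node at which the line starts (reference orientation) -/
  src : Fin l → Fin n
  /-- the node at which the line ends -/
  tgt : Fin l → Fin n
  src_ne_tgt : ∀ e, src e ≠ tgt e
  /-- the susceptance of each line -/
  susc : Fin l → ℝ
  susc_pos : ∀ e, 0 < susc e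
  /-- the capacity of each line -/
  cap : Fin l → ℝ
  connected : (SimpleGraph.fromRel fun u v => ∃ e, src e = u ∧ tgt e = v).Connected
  /-- the reference node -/
  slack : Fin n

namespace Network

variable {n l : ℕ} (N : Network n l)

/-- The line-node incidence matrix: `+1` at the start of a line, `-1` at its end. -/
def incidence : Matrix (Fin l) (Fin n) ℝ := fun e k =>
  (if N.src e = k then 1 else 0) - (if N.tgt e = k then 1 else 0)

/-- The matrix that sends nodal voltage angles `θ` to the DC line flows
`susc e * (θ (src e) - θ (tgt e))`. -/
def branchMatrix : Matrix (Fin l) (Fin n) ℝ := Matrix.diagonal N.susc * N.incidence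

/-- The nodal susceptance matrix (weighted Laplacian), which sends voltage angles to the nodal
power injections: the net outflow at each node. -/
def nodalMatrix : Matrix (Fin n) (Fin n) ℝ := N.incidenceᵀ * N.branchMatrix

/-- The nodal susceptance matrix with the row and the column of the reference node removed. -/
def reducedNodalMatrix : Matrix {k : Fin n // k ≠ N.slack} {k : Fin n // k ≠ N.slack} ℝ :=
  N.nodalMatrix.submatrix Subtype.val Subtype.val

/-- The shift-factor matrix: it sends a (balanced) vector of nodal power injections to the vector
of DC line flows. The column of the reference node is zero. -/
noncomputable def shiftFactor : Matrix (Fin l) (Fin n) ℝ := fun e k =>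
  if h : k ≠ N.slack then
    (N.branchMatrix.submatrix id (Subtype.val : {k : Fin n // k ≠ N.slack} → Fin n) *
      N.reducedNodalMatrix⁻¹) e ⟨k, h⟩
  else 0

end Network

/-- The data of the game: a network whose node `k` carries a generator with cost `c k * x ^ 2` and
a demand with inverse demand function `a k - b k * d`. -/
structure Market (n l : ℕ) extends Network n l where
  a : Fin n → ℝ
  b : Fin n → ℝ
  c : Fin n → ℝ
  a_pos : ∀ k, 0 < a k
  b_nonneg : ∀ k, 0 ≤ b k
  c_pos : ∀ k, 0 < c k

namespace Market

variable {n l : ℕ} (M : Market n l)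

/-- The price at node `k` when the demand there receives the quantity `d`. -/
def price (k : Fin n) (d : ℝ) : ℝ := M.a k - M.b k * d

/-- The production cost of the generator at node `k`. -/
def cost (k : Fin n) (x : ℝ) : ℝ := M.c k * x ^ 2

/-- The profit of the generator at node `k`. -/
def genProfit (k : Fin n) (q r : Fin n → ℝ) : ℝ :=
  q k * M.price k (q k + r k) - M.cost k (q k)

/-- The re-balancing quantities that the market maker may choose, given the production `q`. -/
def rebalancingSet (q : Fin n → ℝ) : Set (Fin n → ℝ) :=
  {r | (∀ k, 0 ≤ q k + r k) ∧ (∀ e, |(M.shiftFactor *ᵥ r) e| ≤ M.cap e) ∧ ∑ k, r k = 0}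

/-- Social welfare: consumers' utility less generation costs. -/
noncomputable def socialWelfare (q r : Fin n → ℝ) : ℝ :=
  ∑ k, ((∫ w in (0 : ℝ)..(q k + r k), M.price k w) - M.cost k (q k))

/-- Residual social welfare: social welfare less the profits of the generators. -/
noncomputable def residualSocialWelfare (q r : Fin n → ℝ) : ℝ :=
  M.socialWelfare q r - ∑ k, M.genProfit k q r

/-- Consumer surplus: consumers' utility less their payments. -/
noncomputable def consumerSurplus (q r : Fin n → ℝ) : ℝ :=
  ∑ k, ((∫ w in (0 : ℝ)..(q k + r k), M.price k w) - (q k + r k) * M.price k (q k + r k))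

/-- The game is feasible: some action profile satisfies all the constraints. -/
def Feasible : Prop :=
  ∃ q r : Fin n → ℝ, (∀ k, 0 ≤ q k) ∧ r ∈ M.rebalancingSet q

/-- `(q, r)` is a generalized Nash equilibrium of the game between the `n` generators and a market
maker with objective `W`. -/
structure IsGNE (W : (Fin n → ℝ) → (Fin n → ℝ) → ℝ) (q r : Fin n → ℝ) : Prop where
  production_nonneg : ∀ k, 0 ≤ q k
  rebalancing_mem : r ∈ M.rebalancingSet q
  generator_optimal : ∀ k, ∀ x : ℝ, 0 ≤ x →
    M.genProfit k (Function.update q k x) r ≤ M.genProfit k q r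
  marketMaker_optimal : ∀ r' ∈ M.rebalancingSet q, W q r' ≤ W q r

end Market

end NetworkedCournot

namespace NetworkedCournot

open Matrix

/-! Existence: the best response of generator `k` depends on `r k` alone. Substituting it into the
market maker's marginal objective leaves a field whose `k`-th component depends only on `r k`. Such
a field is a gradient, so maximizing its potential over a compact convex set solves the variational
inequality (`exists_separable_variational_solution`). The set `rebalancingSet q` moves with `q`, so
`q + r ≥ 0` is replaced by the fixed bounds `r k ≥ -maxExport k`. Where such a bound is active, the
best response is exactly `maxExport k`, so both sets allow the same first-order moves
(`exists_step_mem_exportBoundedSet`). Concavity of the objective in `r` turns the variational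
inequality into optimality.

Non-existence: consumer surplus is a convex quadratic in `r`. On two nodes it is strictly convex in
the single flow, so the market maker always picks an endpoint of the feasible interval. At each
endpoint, the best responses either contradict the capacity bounds or make another feasible flow
strictly better. -/

/-- On a nonempty compact convex set, the variational inequality for a separable continuous field
has a solution: a maximizer of the potential of the field. -/
theorem exists_separable_variational_solution {ι : Type*} [Fintype ι] {K : Set (ι → ℝ)}
    (hK : IsCompact K) (hne : K.Nonempty) (hconv : Convex ℝ K) {F : ι → ℝ → ℝ}
    (hF : ∀ k, Continuous (F k)) :
    ∃ r ∈ K, ∀ r' ∈ K, ∑ k, F k (r k) * (r' k - r k) ≤ 0 := by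
  have hd : ∀ k x, HasDerivAt (fun y => ∫ w in (0 : ℝ)..y, F k w) (F k x) x := fun k x =>
    intervalIntegral.integral_hasDerivAt_right ((hF k).intervalIntegrable _ _)
      ((hF k).stronglyMeasurableAtFilter _ _) (hF k).continuousAt
  have hcont : Continuous fun r : ι → ℝ => ∑ k, ∫ w in (0 : ℝ)..(r k), F k w := by
    refine continuous_finsetSum _ fun k _ => ?_
    have h : Continuous fun y : ℝ => ∫ w in (0 : ℝ)..y, F k w :=
      continuous_iff_continuousAt.2 fun x => (hd k x).continuousAt
    exact h.comp (continuous_apply k)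
  obtain ⟨r, hrK, hr⟩ := hK.exists_isMaxOn hne hcont.continuousOn
  refine ⟨r, hrK, fun r' hr' => ?_⟩
  have hline : ∀ k, HasDerivAt (fun t : ℝ => r k + t * (r' k - r k)) (r' k - r k) 0 := fun k => by
    simpa using ((hasDerivAt_id (0 : ℝ)).mul_const (r' k - r k)).const_add (r k)
  have hder : HasDerivAt (fun t : ℝ => ∑ k, ∫ w in (0 : ℝ)..(r k + t * (r' k - r k)), F k w)
      (∑ k, F k (r k) * (r' k - r k)) 0 := by
    refine HasDerivAt.fun_sum fun k _ => ?_
    have h := hd k (r k + 0 * (r' k - r k))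
    have := HasDerivAt.comp (0 : ℝ) h (hline k)
    simpa [Function.comp_def] using this
  -- Along the segment from `r` to `r'` the potential is maximal at `t = 0`, so its one-sided
  -- derivative there is nonpositive.
  have hmax : IsLocalMaxOn (fun t : ℝ => ∑ k, ∫ w in (0 : ℝ)..(r k + t * (r' k - r k)), F k w)
      (Set.Icc 0 1) 0 := by
    refine IsMaxOn.localize fun t ht => ?_
    have hmem : (fun k => r k + t * (r' k - r k)) ∈ K := by
      have := hconv.add_smul_sub_mem hrK hr' ht
      convert this using 1
      ext k
      simp
    simpa using hr hmem
  have hcone : (1 : ℝ) ∈ posTangentConeAt (Set.Icc (0 : ℝ) 1) 0 :=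
    mem_posTangentConeAt_of_segment_subset (by rw [zero_add, segment_eq_Icc zero_le_one])
  simpa using hmax.hasFDerivWithinAt_nonpos hder.hasFDerivAt.hasFDerivWithinAt hcone

/-! ### Best responses of the generators -/

namespace Market

variable {n l : ℕ} (M : Market n l)

/-- The production that maximizes the profit of the generator at node `k` when the market maker
re-balances the quantity `x` there. -/
noncomputable def bestResponse (k : Fin n) (x : ℝ) : ℝ :=
  max 0 ((M.a k - M.b k * x) / (2 * (M.b k + M.c k)))

/-- The largest export from node `k` that does not exceed the best response to it. -/
noncomputable def maxExport (k : Fin n) : ℝ := M.a k / (M.b k + 2 * M.c k)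

theorem b_add_c_pos (k : Fin n) : 0 < M.b k + M.c k := by
  linarith [M.b_nonneg k, M.c_pos k]

theorem maxExport_pos (k : Fin n) : 0 < M.maxExport k :=
  div_pos (M.a_pos k) (by linarith [M.b_nonneg k, M.c_pos k])

theorem maxExport_mul (k : Fin n) : M.maxExport k * (M.b k + 2 * M.c k) = M.a k :=
  div_mul_cancel₀ _ (by linarith [M.b_nonneg k, M.c_pos k])

theorem bestResponse_nonneg (k : Fin n) (x : ℝ) : 0 ≤ M.bestResponse k x := le_max_left _ _

theorem continuous_bestResponse (k : Fin n) : Continuous (M.bestResponse k) := by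
  unfold bestResponse
  fun_prop

theorem bestResponse_of_nonneg {k : Fin n} {x : ℝ} (h : 0 ≤ M.a k - M.b k * x) :
    M.bestResponse k x = (M.a k - M.b k * x) / (2 * (M.b k + M.c k)) :=
  max_eq_right (div_nonneg h (by linarith [M.b_add_c_pos k]))

/-- `maxExport` is the point where local consumption vanishes: `x = -m` and production `m` satisfy
`2 (b + c) m = a + b m`. -/
theorem bestResponse_neg_maxExport (k : Fin n) :
    M.bestResponse k (-M.maxExport k) = M.maxExport k := by
  have hb := M.b_nonneg k
  have hc := M.c_pos k
  have hm := M.maxExport_mul k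
  have hmp := M.maxExport_pos k
  rw [M.bestResponse_of_nonneg, div_eq_iff (by linarith)]
  · linarith
  · have := mul_nonneg hb hmp.le
    linarith [M.a_pos k]

theorem bestResponse_add_nonneg {k : Fin n} {x : ℝ} (hx : -M.maxExport k ≤ x) :
    0 ≤ M.bestResponse k x + x := by
  have hb := M.b_nonneg k
  have hc := M.c_pos k
  have h1 : -x ≤ (M.a k - M.b k * x) / (2 * (M.b k + M.c k)) := by
    rw [le_div_iff₀ (by linarith), ← M.maxExport_mul k]
    nlinarith [mul_nonneg (by linarith : 0 ≤ M.maxExport k + x)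
      (by linarith : 0 ≤ M.b k + 2 * M.c k)]
  have h2 : (M.a k - M.b k * x) / (2 * (M.b k + M.c k)) ≤ M.bestResponse k x := le_max_right _ _
  linarith

theorem le_profit_bestResponse (k : Fin n) (x : ℝ) {y : ℝ} (hy : 0 ≤ y) :
    y * M.price k (y + x) - M.cost k y ≤
      M.bestResponse k x * M.price k (M.bestResponse k x + x) - M.cost k (M.bestResponse k x) := by
  have hs := M.b_add_c_pos k
  unfold price cost
  rcases le_total 0 (M.a k - M.b k * x) with h | h
  · rw [M.bestResponse_of_nonneg h]
    obtain ⟨z, hz⟩ : ∃ z, z = (M.a k - M.b k * x) / (2 * (M.b k + M.c k)) := ⟨_, rfl⟩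
    have hz' : z * (2 * (M.b k + M.c k)) = M.a k - M.b k * x := by
      rw [hz]; exact div_mul_cancel₀ _ (by linarith)
    rw [← hz]
    nlinarith [mul_nonneg hs.le (sq_nonneg (y - z)), congrArg (· * y) hz', congrArg (· * z) hz']
  · have h0 : M.bestResponse k x = 0 :=
      max_eq_left (div_nonpos_of_nonpos_of_nonneg h (by linarith))
    rw [h0]
    nlinarith [mul_nonneg hs.le (sq_nonneg y), mul_nonneg hy (neg_nonneg.2 h)]

/-- A production level that maximizes a generator's profit is the best response. -/
theorem eq_bestResponse_of_optimal {k : Fin n} {x z : ℝ} (hz : 0 ≤ z)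
    (h : ∀ y, 0 ≤ y → y * M.price k (y + x) - M.cost k y ≤ z * M.price k (z + x) - M.cost k z) :
    z = M.bestResponse k x := by
  have hs := M.b_add_c_pos k
  have h1 := h _ (M.bestResponse_nonneg k x)
  -- By strict concavity, profit at the midpoint of two distinct maximizers would exceed the
  -- maximum.
  have h2 := M.le_profit_bestResponse k x
    (y := (z + M.bestResponse k x) / 2) (by linarith [M.bestResponse_nonneg k x])
  unfold price cost at h1 h2
  have h3 : (M.b k + M.c k) * (z - M.bestResponse k x) ^ 2 ≤ 0 := by nlinarith
  have h4 : (z - M.bestResponse k x) ^ 2 = 0 :=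
    le_antisymm (nonpos_of_mul_nonpos_right h3 hs) (sq_nonneg _)
  exact sub_eq_zero.1 (pow_eq_zero_iff two_ne_zero |>.1 h4)

theorem genProfit_update (k : Fin n) (x : ℝ) (q r : Fin n → ℝ) :
    M.genProfit k (Function.update q k x) r = x * M.price k (x + r k) - M.cost k x := by
  simp [genProfit]

theorem integral_price (k : Fin n) (x : ℝ) :
    ∫ w in (0 : ℝ)..x, M.price k w = M.a k * x - M.b k * x ^ 2 / 2 := by
  unfold price
  rw [intervalIntegral.integral_sub (by simp)
    (Continuous.intervalIntegrable (by fun_prop) _ _), intervalIntegral.integral_const_mul]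
  simp
  ring

/-! ### Rebalancing with fixed export bounds -/

/-- The network constraints together with the bounds that keep every export below `maxExport`. -/
def exportBoundedSet : Set (Fin n → ℝ) :=
  {r | (∀ k, -M.maxExport k ≤ r k) ∧ (∀ e, |(M.shiftFactor *ᵥ r) e| ≤ M.cap e) ∧ ∑ k, r k = 0}

/-- Since the entries sum to zero, lower bounds on all of them also bound each from above. -/
theorem isCompact_exportBoundedSet : IsCompact M.exportBoundedSet := by
  have hsub : M.exportBoundedSet ⊆
      Set.Icc (fun k => -M.maxExport k) (fun _ => ∑ j, M.maxExport j) := by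
    rintro r ⟨h1, -, h3⟩
    refine ⟨h1, fun k => ?_⟩
    have h4 : r k + M.maxExport k ≤ ∑ j, (r j + M.maxExport j) :=
      Finset.single_le_sum (f := fun j => r j + M.maxExport j)
        (fun j _ => by linarith [h1 j]) (Finset.mem_univ k)
    rw [Finset.sum_add_distrib, h3] at h4
    linarith [M.maxExport_pos k]
  refine isCompact_Icc.of_isClosed_subset ?_ hsub
  have hH : Continuous fun r : Fin n → ℝ => M.shiftFactor *ᵥ r :=
    Continuous.matrix_mulVec continuous_const continuous_id
  simp only [exportBoundedSet, Set.ofPred_and, Set.ofPred_forall]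
  refine (isClosed_iInter fun k => isClosed_le continuous_const (continuous_apply k)).inter
    ((isClosed_iInter fun e => isClosed_le ?_ continuous_const).inter
      (isClosed_eq (by fun_prop) continuous_const))
  exact ((continuous_apply e).comp hH).abs

/-- The network constraints are convex. -/
theorem network_constraints_convex {r r' : Fin n → ℝ}
    (h : (∀ e, |(M.shiftFactor *ᵥ r) e| ≤ M.cap e) ∧ ∑ k, r k = 0)
    (h' : (∀ e, |(M.shiftFactor *ᵥ r') e| ≤ M.cap e) ∧ ∑ k, r' k = 0)
    {s t : ℝ} (hs : 0 ≤ s) (ht : 0 ≤ t) (hst : s + t = 1) :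
    (∀ e, |(M.shiftFactor *ᵥ (s • r + t • r')) e| ≤ M.cap e) ∧ ∑ k, (s • r + t • r') k = 0 := by
  refine ⟨fun e => ?_, ?_⟩
  · rw [mulVec_add, mulVec_smul, mulVec_smul]
    exact abs_le.2 ((convex_Icc (-M.cap e) (M.cap e)) (abs_le.1 (h.1 e)) (abs_le.1 (h'.1 e))
      hs ht hst)
  · simp [Finset.sum_add_distrib, ← Finset.mul_sum, h.2, h'.2]

theorem convex_exportBoundedSet : Convex ℝ M.exportBoundedSet := by
  rintro r ⟨h1, h2⟩ r' ⟨h1', h2'⟩ s t hs ht hst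
  refine ⟨fun k => ?_, M.network_constraints_convex h2 h2' hs ht hst⟩
  exact (convex_Ici (-M.maxExport k)) (h1 k) (h1' k) hs ht hst

/-- Feasibility serves only to make the capacities nonnegative. -/
theorem zero_mem_exportBoundedSet (h : M.Feasible) : 0 ∈ M.exportBoundedSet := by
  obtain ⟨q, r, -, -, h2, -⟩ := h
  refine ⟨fun k => by simpa using (M.maxExport_pos k).le, fun e => ?_, by simp⟩
  simpa using (abs_nonneg _).trans (h2 e)

/-- A move inside the re-balancing set at the best responses to `r` is, to first order, a move that
respects the export bounds. -/
theorem exists_step_mem_exportBoundedSet {r r' : Fin n → ℝ} (hr : r ∈ M.exportBoundedSet)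
    (hr' : r' ∈ M.rebalancingSet fun k => M.bestResponse k (r k)) :
    ∃ t : ℝ, 0 < t ∧ (1 - t) • r + t • r' ∈ M.exportBoundedSet := by
  obtain ⟨h1, h2⟩ := hr
  obtain ⟨h1', h2'⟩ := hr'
  have hloc : ∀ k, ∀ᶠ t in nhdsWithin (0 : ℝ) (Set.Ioi 0),
      -M.maxExport k ≤ ((1 - t) • r + t • r') k := by
    intro k
    rcases (h1 k).eq_or_lt with h | h
    -- At an active bound production equals `maxExport k`, so `0 ≤ q k + r' k` is the export bound
    -- for `r'` itself.
    · have hk := h1' k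
      simp only [← h, M.bestResponse_neg_maxExport] at hk
      filter_upwards [self_mem_nhdsWithin] with t ht
      have ht' : 0 < t := ht
      simp only [Pi.add_apply, Pi.smul_apply, smul_eq_mul, ← h]
      nlinarith [mul_nonneg ht'.le hk]
    · have hc : Continuous fun t : ℝ => ((1 - t) • r + t • r') k := by
        simp only [Pi.add_apply, Pi.smul_apply, smul_eq_mul]
        fun_prop
      have : ∀ᶠ t in nhds (0 : ℝ), -M.maxExport k < ((1 - t) • r + t • r') k :=
        hc.continuousAt.eventually_const_lt (by simpa using h)
      exact (this.filter_mono nhdsWithin_le_nhds).mono fun t ht => ht.le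
  have hone : ∀ᶠ t in nhdsWithin (0 : ℝ) (Set.Ioi 0), t ∈ Set.Ioo (0 : ℝ) 1 :=
    Ioo_mem_nhdsGT zero_lt_one
  obtain ⟨t, ht, hk⟩ := (hone.and (Filter.eventually_all.2 hloc)).exists
  exact ⟨t, ht.1, hk, M.network_constraints_convex h2 h2' (by linarith [ht.2]) ht.1.le (by ring)⟩

/-! ### Existence for the two welfare objectives -/

/-- An equilibrium exists as soon as the market maker's objective, at best-responding generators,
is dominated by its linearization along a separable continuous field. -/
theorem exists_isGNE_of_separable_field (hM : M.Feasible)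
    {W : (Fin n → ℝ) → (Fin n → ℝ) → ℝ} {F : Fin n → ℝ → ℝ} (hF : ∀ k, Continuous (F k))
    (hW : ∀ r r' : Fin n → ℝ, W (fun k => M.bestResponse k (r k)) r' -
      W (fun k => M.bestResponse k (r k)) r ≤ ∑ k, F k (r k) * (r' k - r k)) :
    ∃ q r : Fin n → ℝ, M.IsGNE W q r := by
  obtain ⟨r, hr, hvi⟩ := exists_separable_variational_solution M.isCompact_exportBoundedSet
    ⟨0, M.zero_mem_exportBoundedSet hM⟩ M.convex_exportBoundedSet hF
  refine ⟨fun k => M.bestResponse k (r k), r, fun k => M.bestResponse_nonneg k _,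
    ⟨fun k => M.bestResponse_add_nonneg (hr.1 k), hr.2⟩, fun k x hx => ?_, fun r' hr' => ?_⟩
  · rw [genProfit_update]
    exact M.le_profit_bestResponse k (r k) hx
  · obtain ⟨t, ht, hmem⟩ := M.exists_step_mem_exportBoundedSet hr hr'
    have h := hvi _ hmem
    have hsum : ∑ k, F k (r k) * (((1 - t) • r + t • r') k - r k) =
        t * ∑ k, F k (r k) * (r' k - r k) := by
      rw [Finset.mul_sum]
      refine Finset.sum_congr rfl fun k _ => ?_
      simp only [Pi.add_apply, Pi.smul_apply, smul_eq_mul]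
      ring
    rw [hsum] at h
    linarith [hW r r', nonpos_of_mul_nonpos_right h ht]

theorem exists_isGNE_socialWelfare (hM : M.Feasible) :
    ∃ q r : Fin n → ℝ, M.IsGNE M.socialWelfare q r := by
  refine M.exists_isGNE_of_separable_field hM
    (F := fun k x => M.a k - M.b k * (M.bestResponse k x + x)) (fun k => ?_) fun r r' => ?_
  · have := M.continuous_bestResponse k
    fun_prop
  · simp only [socialWelfare, integral_price]
    rw [← Finset.sum_sub_distrib]
    refine Finset.sum_le_sum fun k _ => ?_
    nlinarith [mul_nonneg (M.b_nonneg k) (sq_nonneg (r' k - r k))]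

/-- The profit term contributes `b k * q k` to the derivative in `r k`, which cancels the production
from the marginal price and leaves `a k - b k * r k`. -/
theorem exists_isGNE_residualSocialWelfare (hM : M.Feasible) :
    ∃ q r : Fin n → ℝ, M.IsGNE M.residualSocialWelfare q r := by
  refine M.exists_isGNE_of_separable_field hM
    (F := fun k x => M.a k - M.b k * x) (fun k => by fun_prop) fun r r' => ?_
  simp only [residualSocialWelfare, socialWelfare, integral_price]
  rw [← Finset.sum_sub_distrib, ← Finset.sum_sub_distrib, ← Finset.sum_sub_distrib]
  refine Finset.sum_le_sum fun k _ => ?_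
  simp only [genProfit, price, cost]
  nlinarith [mul_nonneg (M.b_nonneg k) (sq_nonneg (r' k - r k))]

end Market

/-! ### Non-existence under consumer surplus -/

/-- On two nodes joined by a single line, the flow equals the net injection up to sign. -/
theorem Network.abs_shiftFactor_two_nodes (N : Network 2 1) {r : Fin 2 → ℝ} (hr : ∑ k, r k = 0)
    (e : Fin 1) : |(N.shiftFactor *ᵥ r) e| = |r 0| := by
  have hs : N.susc 0 ≠ 0 := (N.susc_pos 0).ne'
  have hst := N.src_ne_tgt 0
  have hr1 : r 1 = -r 0 := by
    rw [Fin.sum_univ_two] at hr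
    linarith
  have he : e = 0 := Subsingleton.elim _ _
  subst he
  have hsub : Subsingleton {k : Fin 2 // k ≠ N.slack} :=
    ⟨fun x y => Subtype.ext (by have := x.2; have := y.2; omega)⟩
  -- Only one node is not the reference, so the matrix is the scalar susceptance, which cancels in
  -- the shift factor and leaves `±1`.
  have hred : N.reducedNodalMatrix = N.susc 0 • (1 : Matrix _ _ ℝ) := by
    ext i j
    obtain rfl : i = j := Subsingleton.elim _ _
    have h : N.src 0 = i.1 ∧ N.tgt 0 ≠ i.1 ∨ N.src 0 ≠ i.1 ∧ N.tgt 0 = i.1 := by omega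
    rcases h with ⟨h1, h2⟩ | ⟨h1, h2⟩ <;>
    simp [reducedNodalMatrix, nodalMatrix, branchMatrix, incidence, Matrix.mul_apply,
      Matrix.diagonal_apply, h1, h2]
  have hinv : N.reducedNodalMatrix⁻¹ = (N.susc 0)⁻¹ • (1 : Matrix _ _ ℝ) := by
    apply Matrix.inv_eq_left_inv
    rw [hred, smul_mul_smul_comm, inv_mul_cancel₀ hs, one_smul, one_mul]
  have hcol : ∀ k, k ≠ N.slack → |N.shiftFactor 0 k| = 1 := by
    intro k hk
    have h : N.src 0 = k ∧ N.tgt 0 ≠ k ∨ N.src 0 ≠ k ∧ N.tgt 0 = k := by omega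
    rcases h with ⟨h1, h2⟩ | ⟨h1, h2⟩ <;>
    simp [shiftFactor, hk, hinv, branchMatrix, incidence, Matrix.diagonal_mul, h1, h2, hs]
  have hcol0 : N.shiftFactor 0 N.slack = 0 := by simp [shiftFactor]
  simp only [Matrix.mulVec, dotProduct, Fin.sum_univ_two]
  have hsl : N.slack = 0 ∨ N.slack = 1 := by omega
  rcases hsl with h | h
  · rw [h] at hcol0
    rw [hcol0, zero_mul, zero_add, abs_mul, hcol 1 (by rw [h]; decide), hr1, abs_neg, one_mul]
  · rw [h] at hcol0
    rw [hcol0, zero_mul, add_zero, abs_mul, hcol 0 (by rw [h]; decide), one_mul]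

namespace Market

theorem consumerSurplus_eq {n l : ℕ} (M : Market n l) (q r : Fin n → ℝ) :
    M.consumerSurplus q r = ∑ k, M.b k * (q k + r k) ^ 2 / 2 := by
  unfold consumerSurplus
  refine Finset.sum_congr rfl fun k _ => ?_
  rw [integral_price, price]
  ring

/-- The equilibrium conditions under consumer surplus on two nodes joined by a single line. -/
theorem IsGNE.two_nodes {M : Market 2 1} {q r : Fin 2 → ℝ} (h : M.IsGNE M.consumerSurplus q r) :
    r 1 = -r 0 ∧ |r 0| ≤ M.cap 0 ∧ 0 ≤ q 0 + r 0 ∧ 0 ≤ q 1 - r 0 ∧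
    q 0 = M.bestResponse 0 (r 0) ∧ q 1 = M.bestResponse 1 (-r 0) ∧
    ∀ x, |x| ≤ M.cap 0 → 0 ≤ q 0 + x → 0 ≤ q 1 - x →
      M.b 0 * (q 0 + x) ^ 2 + M.b 1 * (q 1 - x) ^ 2 ≤
        M.b 0 * (q 0 + r 0) ^ 2 + M.b 1 * (q 1 - r 0) ^ 2 := by
  obtain ⟨h1, h2, h3⟩ := h.rebalancing_mem
  have hr1 : r 1 = -r 0 := by
    rw [Fin.sum_univ_two] at h3
    linarith
  have hq : ∀ k, q k = M.bestResponse k (r k) := fun k =>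
    M.eq_bestResponse_of_optimal (h.production_nonneg k) fun y hy => by
      simpa [genProfit_update, genProfit] using h.generator_optimal k y hy
  refine ⟨hr1, ?_, h1 0, ?_, hq 0, hr1 ▸ hq 1, fun x hx hx0 hx1 => ?_⟩
  · rw [← M.abs_shiftFactor_two_nodes h3 0]
    exact h2 0
  · have := h1 1
    rw [hr1] at this
    linarith
  · have hsum : ∑ k, (![x, -x] : Fin 2 → ℝ) k = 0 := by simp
    have hm := h.marketMaker_optimal ![x, -x] ⟨fun k => ?_, fun e => ?_, hsum⟩
    · simp only [consumerSurplus_eq, Fin.sum_univ_two, hr1] at hm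
      simp at hm
      simp only [← sub_eq_add_neg] at hm
      linarith
    · fin_cases k
      · simpa using hx0
      · simpa using hx1
    · rw [M.abs_shiftFactor_two_nodes hsum, Subsingleton.elim e 0]
      simpa using hx

/-- A maximizer of a strictly convex quadratic on an interval is an endpoint. -/
theorem eq_endpoint_of_quadratic_max {b₁ b₂ q₁ q₂ lo hi x : ℝ} (hb : 0 < b₁ + b₂)
    (hlo : lo ≤ x) (hhi : x ≤ hi)
    (hmax : ∀ y, lo ≤ y → y ≤ hi → b₁ * (q₁ + y) ^ 2 + b₂ * (q₂ - y) ^ 2 ≤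
      b₁ * (q₁ + x) ^ 2 + b₂ * (q₂ - x) ^ 2) : x = lo ∨ x = hi := by
  by_contra! hne
  have h1 : 0 < x - lo := sub_pos.2 (lt_of_le_of_ne hlo hne.1.symm)
  have h2 : 0 < hi - x := sub_pos.2 (lt_of_le_of_ne hhi hne.2)
  obtain ⟨d, hd, hd1, hd2⟩ : ∃ d, 0 < d ∧ d ≤ x - lo ∧ d ≤ hi - x :=
    ⟨min (x - lo) (hi - x), lt_min h1 h2, min_le_left _ _, min_le_right _ _⟩
  -- The values at `x - d` and `x + d` average to the value at `x` plus `(b₁ + b₂) * d ^ 2`.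
  have h3 := hmax (x - d) (by linarith) (by linarith)
  have h4 := hmax (x + d) (by linarith) (by linarith)
  nlinarith [mul_pos hb (pow_pos hd 2)]

theorem not_exists_isGNE_consumerSurplus (M : Market 2 1) {a b₁ b₂ c f : ℝ}
    (ha0 : M.a 0 = a) (ha1 : M.a 1 = a) (hb0 : M.b 0 = b₁) (hb1 : M.b 1 = b₂)
    (hc0 : M.c 0 = c) (hc1 : M.c 1 = c) (hcap : M.cap 0 = f) (hratio : 1 < b₁ / b₂)
    (hf : a / (3 * b₁ + 2 * c) < f) (hf1 : f < a / (b₂ + 2 * c)) (hf2 : f < a / b₁)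
    (hf3 : f < a * b₂ * (b₁ + b₂ + c * (3 - b₁ / b₂)) /
      (b₁ * b₂ * (b₁ + b₂) + b₁ * (b₁ + 5 * b₂) * c + 2 * (b₁ + b₂) * c ^ 2)) :
    ¬ ∃ q r : Fin 2 → ℝ, M.IsGNE M.consumerSurplus q r := by
  rintro ⟨q, r, h⟩
  have ha : 0 < a := ha0 ▸ M.a_pos 0
  have hc : 0 < c := hc0 ▸ M.c_pos 0
  have hb2 : 0 < b₂ := by
    -- If `b₂ = 0` then `b₁ / b₂` is `0` by convention, contradicting `1 < b₁ / b₂`.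
    refine lt_of_le_of_ne (hb1 ▸ M.b_nonneg 1) fun h0 => ?_
    rw [← h0, div_zero] at hratio
    linarith
  have hb12 : b₂ < b₁ := by rwa [one_lt_div hb2] at hratio
  have hb1' : 0 < b₁ := hb2.trans hb12
  have hfpos : 0 < f := lt_trans (by positivity) hf
  rw [div_lt_iff₀ (by positivity)] at hf
  rw [lt_div_iff₀ (by positivity)] at hf1 hf2 hf3
  have hnum : a * b₂ * (b₁ + b₂ + c * (3 - b₁ / b₂)) =
      a * (b₁ * b₂ + b₂ ^ 2 + 3 * b₂ * c - b₁ * c) := by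
    field_simp
    ring
  rw [hnum] at hf3
  obtain ⟨-, hrf, hlo, hhi, hq0, hq1, hmax⟩ := h.two_nodes
  rw [hcap] at hrf hmax
  rw [hb0, hb1] at hmax
  obtain ⟨hrf1, hrf2⟩ := abs_le.1 hrf
  generalize r 0 = x at *
  -- The bound `f < a / b₁` keeps both best responses positive, hence given by the linear formula.
  have hp0 : 0 < a - b₁ * x := by linarith [mul_le_mul_of_nonneg_left hrf2 hb1'.le]
  have hp1 : 0 < a - b₂ * -x := by
    linarith [mul_le_mul_of_nonneg_left hrf1 hb2.le, mul_pos (sub_pos.2 hb12) hfpos]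
  rw [M.bestResponse_of_nonneg (by rw [ha0, hb0]; exact hp0.le), ha0, hb0, hc0,
    eq_div_iff (by positivity)] at hq0
  rw [M.bestResponse_of_nonneg (by rw [ha1, hb1]; exact hp1.le), ha1, hb1, hc1,
    eq_div_iff (by positivity)] at hq1
  generalize q 0 = q₁ at *
  generalize q 1 = q₂ at *
  have hend := eq_endpoint_of_quadratic_max (b₁ := b₁) (b₂ := b₂) (q₁ := q₁) (q₂ := q₂)
    (lo := max (-f) (-q₁)) (hi := min f q₂) (x := x) (by positivity)
    (max_le hrf1 (by linarith)) (le_min hrf2 (by linarith)) fun y hy1 hy2 => by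
      rw [max_le_iff] at hy1
      rw [le_min_iff] at hy2
      exact hmax y (abs_le.2 ⟨hy1.1, hy2.1⟩) (by linarith) (by linarith)
  have hq1pos : 0 < q₁ := by
    by_contra! hneg
    linarith [mul_nonneg (neg_nonneg.2 hneg) (by positivity : 0 ≤ b₁ + c)]
  have hq2pos : 0 < q₂ := by
    by_contra! hneg
    linarith [mul_nonneg (neg_nonneg.2 hneg) (by positivity : 0 ≤ b₂ + c)]
  rcases hend with hx | hx
  · rcases le_total f q₁ with hfq | hfq
    · -- the line is congested towards node `1`
      rw [max_eq_left (by linarith)] at hx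
      subst hx
      rcases le_total f q₂ with hfq2 | hfq2
      -- Reversing the flow from `-f` to `f` gains `4 * f * (b₁ * q₁ - b₂ * q₂)`, which is positive
      -- here.
      · have h1 := hmax f (by rw [abs_of_pos hfpos]) (by linarith) (by linarith)
        have h2 : b₁ * q₁ ≤ b₂ * q₂ := by
          have : f * (b₁ * q₁) ≤ f * (b₂ * q₂) := by linarith
          exact le_of_mul_le_mul_left this hfpos
        have h3 : (b₁ * q₁) * (2 * (b₁ + c) * (b₂ + c)) ≤
            (b₂ * q₂) * (2 * (b₁ + c) * (b₂ + c)) :=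
          mul_le_mul_of_nonneg_right h2 (by positivity)
        have h4 : (b₁ * q₁) * (2 * (b₁ + c) * (b₂ + c)) =
            b₁ * (b₂ + c) * (a + b₁ * f) := by
          linear_combination b₁ * (b₂ + c) * hq0
        have h5 : (b₂ * q₂) * (2 * (b₁ + c) * (b₂ + c)) =
            b₂ * (b₁ + c) * (a - b₂ * f) := by
          linear_combination b₂ * (b₁ + c) * hq1
        rw [h4, h5] at h3
        have h6 : 0 < b₁ * (b₂ + c) * (b₁ * f) := by positivity
        have h7 : 0 < b₂ * (b₁ + c) * (b₂ * f) := by positivity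
        have h8 : 0 < a * c * (b₁ - b₂) := mul_pos (by positivity) (by linarith)
        linarith
      · have h1 := hmax q₂ (by rw [abs_of_pos hq2pos]; exact hfq2) (by linarith) (by linarith)
        have h2 : 0 < (q₂ + f) * (b₁ * (2 * q₁ + q₂ - f) - b₂ * (q₂ + f)) := by
          refine mul_pos (by linarith) ?_
          linarith [mul_nonneg hb1'.le (sub_nonneg.2 hfq),
            mul_pos (sub_pos.2 hb12) (by linarith : 0 < q₂ + f)]
        linarith
    · -- the whole production of node `0` is exported
      rw [max_eq_right (by linarith)] at hx
      subst hx
      rcases le_total f q₂ with hfq2 | hfq2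
      · have h1 := hmax f (by rw [abs_of_pos hfpos]) (by linarith) (by linarith)
        have h2 : 0 < (q₁ + f) * (b₁ * (q₁ + f) - b₂ * (q₁ + 2 * q₂ - f)) := by
          refine mul_pos (by linarith) ?_
          have h3 : 0 < (b₁ * (q₁ + f) - b₂ * (q₁ + 2 * q₂ - f)) * (b₂ + c) := by
            have h4 : a = (b₁ + 2 * c) * q₁ := by linarith
            have h5 : 2 * q₂ * (b₂ + c) = q₁ * (b₁ - b₂ + 2 * c) := by
              rw [h4] at hq1
              linarith
            have h6 : (b₁ * (q₁ + f) - b₂ * (q₁ + 2 * q₂ - f)) * (b₂ + c) =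
                (b₁ + b₂) * (b₂ + c) * (f - q₁) +
                  q₁ * (b₁ * b₂ + b₂ ^ 2 + 2 * c * (b₁ - b₂)) := by
              linear_combination (-b₂) * h5
            rw [h6]
            have h7 : 0 < b₁ - b₂ := sub_pos.2 hb12
            have h8 : 0 ≤ f - q₁ := sub_nonneg.2 hfq
            positivity
          exact pos_of_mul_pos_left h3 (by positivity)
        linarith
      · have h1 := hmax q₂ (by rw [abs_of_pos hq2pos]; exact hfq2) (by linarith) (by linarith)
        linarith [mul_pos (sub_pos.2 hb12) (pow_pos (by linarith : 0 < q₁ + q₂) 2)]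
  · rcases lt_or_ge q₂ f with hfq2 | hfq2
    · rw [min_eq_right hfq2.le] at hx
      subst hx
      -- Exporting all of `q₂` forces `q₂ = a / (b₂ + 2 * c)`, which exceeds `f`.
      linarith [mul_pos (sub_pos.2 hfq2) (by positivity : 0 < b₂ + 2 * c)]
    · -- the line is congested towards node `0`
      rw [min_eq_left hfq2] at hx
      subst hx
      -- This is the lower bound on `f`; it makes the flow `-q₁` feasible. The third upper bound on
      -- `f` says exactly that `-q₁` beats `f`.
      have hfq : q₁ < x := by
        by_contra! hge
        linarith [mul_nonneg (sub_nonneg.2 hge) (by positivity : 0 ≤ b₁ + c)]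
      have h1 := hmax (-q₁) (by rw [abs_neg, abs_of_pos hq1pos]; exact hfq.le) (by linarith)
        (by linarith)
      have h2 : 0 < (b₂ * (q₁ + 2 * q₂ - x) - b₁ * (q₁ + x)) * (2 * (b₁ + c) * (b₂ + c)) := by
        have h3 : (b₂ * (q₁ + 2 * q₂ - x) - b₁ * (q₁ + x)) * (2 * (b₁ + c) * (b₂ + c)) =
            a * (b₁ * b₂ + b₂ ^ 2 + 3 * b₂ * c - b₁ * c) -
            x * (b₁ * b₂ * (b₁ + b₂) + b₁ * (b₁ + 5 * b₂) * c + 2 * (b₁ + b₂) * c ^ 2) := by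
          linear_combination (b₂ - b₁) * (b₂ + c) * hq0 + 2 * b₂ * (b₁ + c) * hq1
        rw [h3]
        linarith
      have h4 := mul_pos (by linarith : 0 < q₁ + x) (pos_of_mul_pos_left h2 (by positivity))
      linarith

/-- Two nodes joined by a single line of capacity `2`. -/
def twoNodeExample : Market 2 1 where
  src _ := 0
  tgt _ := 1
  src_ne_tgt _ := by decide
  susc _ := 1
  susc_pos _ := one_pos
  cap _ := 2
  connected := by
    have : (SimpleGraph.fromRel fun u v : Fin 2 => ∃ _ : Fin 1, 0 = u ∧ 1 = v) = ⊤ := by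
      ext u v
      fin_cases u <;> fin_cases v <;> simp
    rw [this]
    exact SimpleGraph.connected_top
  slack := 0
  a _ := 10
  b := ![1.2, 1]
  c _ := 1
  a_pos _ := by norm_num
  b_nonneg k := by fin_cases k <;> norm_num
  c_pos _ := one_pos

end Market

end NetworkedCournot

theorem theorem1 :
    -- existence under social welfare and under residual social welfare
    (∀ (n l : ℕ) (M : NetworkedCournot.Market n l), M.Feasible →
      (∃ q r : Fin n → ℝ, M.IsGNE M.socialWelfare q r) ∧
      (∃ q r : Fin n → ℝ, M.IsGNE M.residualSocialWelfare q r)) ∧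
    -- non-existence under consumer surplus: two nodes joined by a single line
    (∀ (M : NetworkedCournot.Market 2 1) (a b₁ b₂ c f : ℝ),
      M.a 0 = a → M.a 1 = a → M.b 0 = b₁ → M.b 1 = b₂ → M.c 0 = c → M.c 1 = c → M.cap 0 = f →
      1 < b₁ / b₂ → b₁ / b₂ ≤ 3 →
      a / (3 * b₁ + 2 * c) < f →
      f < min (a / (b₂ + 2 * c)) (min (a / b₁)
        (a * b₂ * (b₁ + b₂ + c * (3 - b₁ / b₂)) /
          (b₁ * b₂ * (b₁ + b₂) + b₁ * (b₁ + 5 * b₂) * c + 2 * (b₁ + b₂) * c ^ 2))) →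
      ¬ ∃ q r : Fin 2 → ℝ, M.IsGNE M.consumerSurplus q r) ∧
    -- a concrete feasible instance without equilibrium
    (∃ M : NetworkedCournot.Market 2 1,
      M.a 0 = 10 ∧ M.a 1 = 10 ∧ M.b 0 = 1.2 ∧ M.b 1 = 1 ∧ M.c 0 = 1 ∧ M.c 1 = 1 ∧ M.cap 0 = 2 ∧
      M.Feasible ∧ ¬ ∃ q r : Fin 2 → ℝ, M.IsGNE M.consumerSurplus q r) := by
  refine ⟨fun n l M hM => ⟨M.exists_isGNE_socialWelfare hM, M.exists_isGNE_residualSocialWelfare hM⟩,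
    fun M a b₁ b₂ c f ha0 ha1 hb0 hb1 hc0 hc1 hcap h1 _ hf hf' => ?_,
    NetworkedCournot.Market.twoNodeExample, rfl, rfl, rfl, rfl, rfl, rfl, rfl,
    ⟨0, 0, fun _ => le_rfl, fun _ => by simp, fun _ => ?_, by simp⟩, ?_⟩
  · rw [lt_min_iff, lt_min_iff] at hf'
    exact M.not_exists_isGNE_consumerSurplus ha0 ha1 hb0 hb1 hc0 hc1 hcap h1 hf hf'.1 hf'.2.1
      hf'.2.2
  · simp [NetworkedCournot.Market.twoNodeExample]
  · refine NetworkedCournot.Market.twoNodeExample.not_exists_isGNE_consumerSurplus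
      (a := 10) (b₁ := 1.2) (b₂ := 1) (c := 1) (f := 2) rfl rfl rfl rfl rfl rfl rfl ?_ ?_ ?_ ?_ ?_
      <;> norm_num
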